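/- An algebra $\mathbf A=(A;F)$ is a set $A$ with a family $F$ of finitary (basic) operations; it is idempotent if $f(x,\dots,x)=x$ for every basic operation $f$. $\mathrm{Clo}(\mathbf A)$ is the clone generated by $F$ (the term operations), $\mathrm{Inv}(\mathbf A)$ the set of relations on $A$ preserved by all basic operations, and $\mathrm{Sg}_{\mathbf A}(R)$ the subalgebra of $\mathbf A^n$ generated by $R\subseteq A^n$. A subuniverse $B\subseteq A$ (a subset closed under all basic operations) is nontrivial if $\varnothing\ne B\ne A$. A subuniverse $B$ is - absorbing if some $t\in\mathrm{Clo}(\mathbf A)$ satisfies $t(B,\dots,B,A,B,\dots,B)\subseteq B$ for every position of $A$, and binary absorbing if $t$ can be chosen binary; - central if it is absorbing and $(a,a)\notin \mathrm{Sg}_{\mathbf A}((\{a\}\times B)\cup(B\times\{a\}))$ for every $a\in A\setminus B$; - projective if every basic operation $f$ has a coordinate $i$ such that $f(a_1,\dots,a_n)\in B$ whenever $a_i\in B$; - PC if $B=A$, or $B=\varnothing$, or $B$ is a block of a congruence $\sigma$ with $\mathbf A/\sigma\cong \mathbf D_1\times\dots\times\mathbf D_s$, where each $\mathbf D_i$ is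 polynomially complete (its basic operations together with all constant operations generate the clone of all operations on $D_i$) and has no nontrivial binary absorbing, central or projective subuniverse. For a prime $p$, a finite idempotent algebra $\mathbf A$ is $p$-affine if there are operations $\oplus,\ominus$ on $A$ such that $(A;\oplus,\ominus)\cong(\mathbb Z_p^s;+,-)$ for some $s\ge 1$, the relation $x_1\oplus x_2=x_3\oplus x_4$ belongs to $\mathrm{Inv}(\mathbf A)$, and $x\ominus y\oplus z\in\mathrm{Clo}(\mathbf A)$. Theorem. Every finite idempotent algebra $\mathbf A$ of size at least $2$ has 1. a nontrivial binary absorbing subuniverse, or 2. a nontrivial central subuniverse, or 3. a nontrivial PC subuniverse, or 4. a congruence $\sigma$ such that $\mathbf A/\sigma$ is $p$-affine for some prime $p$, or 5. a nontrivial projective subuniverse. -/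

import Mathlib

/-!
Finite idempotent algebras and their strong subuniverses.

An algebra is a structure over a first-order language without relation symbols; the basic
operations are the interpretations of the function symbols, and a subuniverse is a
`FirstOrder.Language.Substructure` (which may be empty).
-/

universe u v w

namespace UnivAlg

open FirstOrder FirstOrder.Language FirstOrder.Language.Structure

/-! ### Clones and invariant relations -/

/-- The clone generated by a family `F` of operations on `A` (`F n` holds the `n`-ary ones):
the least family that contains the projections and is closed under composition with
members of `F`. It is closed under arbitrary composition, see `CloneGen.superpose`. -/
inductive CloneGen {A : Type w} (F : ∀ n : ℕ, Set ((Fin n → A) → A)) :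
    ∀ {n : ℕ}, ((Fin n → A) → A) → Prop
  | proj {n : ℕ} (i : Fin n) : CloneGen F (fun x : Fin n → A => x i)
  | comp {m n : ℕ} (f : (Fin m → A) → A) (hf : f ∈ F m) (g : Fin m → (Fin n → A) → A)
      (hg : ∀ j, CloneGen F (g j)) : CloneGen F (fun x => f (fun j => g j x))

theorem CloneGen.of_mem {A : Type w} {F : ∀ n : ℕ, Set ((Fin n → A) → A)} {n : ℕ}
    {f : (Fin n → A) → A} (hf : f ∈ F n) : CloneGen F f :=
  CloneGen.comp f hf (fun j x => x j) (fun j => CloneGen.proj j)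

theorem CloneGen.superpose {A : Type w} {F : ∀ n : ℕ, Set ((Fin n → A) → A)} {m n : ℕ}
    {f : (Fin m → A) → A} (hf : CloneGen F f) {g : Fin m → (Fin n → A) → A}
    (hg : ∀ j, CloneGen F (g j)) : CloneGen F (fun x => f (fun j => g j x)) := by
  induction hf with
  | proj i => exact hg i
  | comp f hf h _ ih => exact CloneGen.comp f hf _ (fun j => ih j hg)

section Algebra

variable (L : FirstOrder.Language.{u, v}) (A : Type w) [L.Structure A]

/-- The basic operations of the algebra `A`. -/
def basicOps (n : ℕ) : Set ((Fin n → A) → A) :=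
  Set.range fun (f : L.Functions n) (x : Fin n → A) => funMap f x

/-- The constant operations on `A`. -/
def constOps (A : Type w) (n : ℕ) : Set ((Fin n → A) → A) :=
  {f | ∃ a : A, f = fun _ => a}

/-- Every basic operation satisfies `f (x, x, …, x) = x`. -/
def IsIdempotent : Prop :=
  ∀ (n : ℕ) (f : L.Functions n) (a : A), funMap f (fun _ : Fin n => a) = a

/-- Polynomially complete: the basic operations and the constants generate all operations. -/
def IsPolynomiallyComplete : Prop :=
  ∀ (n : ℕ) (f : (Fin n → A) → A), CloneGen (fun k => basicOps L A k ∪ constOps A k) f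

variable {A}

/-- `t` is a term operation of the algebra `A`, that is, `t ∈ Clo(A)`. -/
def IsTermOperation {n : ℕ} (t : (Fin n → A) → A) : Prop :=
  CloneGen (basicOps L A) t

/-- `R ∈ Inv(A)`: the relation `R` is preserved by every basic operation of `A`. -/
def IsInvariant {k : ℕ} (R : Set (Fin k → A)) : Prop :=
  ∀ (n : ℕ) (f : L.Functions n) (α : Fin n → Fin k → A), (∀ i, α i ∈ R) →
    (fun j => funMap f (fun i => α i j)) ∈ R

end Algebra

/-! ### Products and quotients -/

/-- The direct product of a family of algebras. -/
instance piStructure (L : FirstOrder.Language.{u, v}) {ι : Type*} (D : ι → Type*)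
    [∀ i, L.Structure (D i)] : L.Structure (∀ i, D i) where
  funMap f x := fun i => funMap f (fun j => x j i)
  RelMap r x := ∀ i, RelMap r (fun j => x j i)

/-- A congruence: an equivalence relation preserved by every basic operation. -/
structure Congruence (L : FirstOrder.Language.{u, v}) (A : Type w) [L.Structure A] extends Setoid A where
  preserved : ∀ {n : ℕ} (f : L.Functions n) (x y : Fin n → A),
    (∀ i, toSetoid (x i) (y i)) → toSetoid (funMap f x) (funMap f y)

section Quotient

variable {L : FirstOrder.Language.{u, v}} [L.IsAlgebraic] {A : Type w} [L.Structure A]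

/-- The universe of the factor algebra. -/
def Congruence.Quot (σ : Congruence L A) : Type w := Quotient σ.toSetoid

/-- The class of an element in the factor algebra. -/
def Congruence.cls (σ : Congruence L A) (a : A) : σ.Quot := Quotient.mk σ.toSetoid a

/-- The factor algebra; its operations are computed on representatives, see
`Congruence.funMap_cls`. -/
noncomputable instance Congruence.quotStructure (σ : Congruence L A) : L.Structure σ.Quot where
  funMap f x := σ.cls (funMap f (fun i => Quotient.out (s := σ.toSetoid) (x i)))
  RelMap r _ := isEmptyElim r

theorem Congruence.funMap_cls (σ : Congruence L A) {n : ℕ} (f : L.Functions n) (x : Fin n → A) :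
    funMap f (fun i => σ.cls (x i)) = σ.cls (funMap f x) :=
  Quotient.sound (s := σ.toSetoid)
    (σ.preserved f _ _ fun _ => Quotient.exact (s := σ.toSetoid) (Quotient.out_eq _))

end Quotient

/-! ### Absorbing, central and projective subuniverses -/

section Subuniverses

variable {L : FirstOrder.Language.{u, v}} {A : Type w} [L.Structure A]

/-- A subuniverse is nontrivial if it is proper and nonempty. -/
def IsNontrivial (B : L.Substructure A) : Prop :=
  (B : Set A).Nonempty ∧ (B : Set A) ≠ Set.univ

/-- `t (B, …, B, A, B, …, B) ⊆ B` for every position of `A`. -/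
def AbsorbsWith (B : L.Substructure A) {n : ℕ} (t : (Fin n → A) → A) : Prop :=
  ∀ (i : Fin n) (x : Fin n → A), (∀ j, j ≠ i → x j ∈ B) → t x ∈ B

/-- `B` absorbs `A` with some term operation (of positive arity). -/
def IsAbsorbing (B : L.Substructure A) : Prop :=
  ∃ (n : ℕ) (t : (Fin n → A) → A), 0 < n ∧ IsTermOperation L t ∧ AbsorbsWith B t

/-- `B` absorbs `A` with a binary term operation. -/
def IsBinaryAbsorbing (B : L.Substructure A) : Prop :=
  ∃ t : (Fin 2 → A) → A, IsTermOperation L t ∧ AbsorbsWith B t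

/-- The set `({a} × C) ∪ (C × {a})` of pairs. -/
def crossPairs (C : L.Substructure A) (a : A) : Set (Fin 2 → A) :=
  {x | (x 0 = a ∧ x 1 ∈ C) ∨ (x 0 ∈ C ∧ x 1 = a)}

/-- `C` is absorbing, and `(a, a)` is never in the subalgebra of `A × A` generated by
`({a} × C) ∪ (C × {a})` for `a ∉ C`. -/
def IsCentral (C : L.Substructure A) : Prop :=
  IsAbsorbing C ∧
    ∀ a : A, a ∉ C → (fun _ : Fin 2 => a) ∉ Substructure.closure L (crossPairs C a)

/-- Every basic operation `f` has a coordinate `i` with `f (A, …, A, B, A, …, A) ⊆ B`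
(`B` at position `i`). -/
def IsProjective (B : L.Substructure A) : Prop :=
  ∀ (n : ℕ) (f : L.Functions n), ∃ i : Fin n, ∀ x : Fin n → A, x i ∈ B → funMap f x ∈ B

end Subuniverses

/-! ### PC subuniverses and affine algebras -/

/-- A polynomially complete algebra without nontrivial binary absorbing, central or projective
subuniverses. -/
def IsPCWithoutBACP (L : FirstOrder.Language.{u, v}) (D : Type w) [L.Structure D] : Prop :=
  IsPolynomiallyComplete L D ∧
    ¬ ∃ B : L.Substructure D,
      IsNontrivial B ∧ (IsBinaryAbsorbing B ∨ IsCentral B ∨ IsProjective B)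

/-- `B` is `A`, or empty, or a block of a congruence `σ` such that `A/σ` is isomorphic to a
product `D₁ × ⋯ × Dₛ` of polynomially complete algebras without nontrivial binary absorbing,
central or projective subuniverses. -/
def IsPCSubuniverse {L : FirstOrder.Language.{u, v}} [L.IsAlgebraic] {A : Type w} [L.Structure A]
    (B : L.Substructure A) : Prop :=
  (B : Set A) = Set.univ ∨ (B : Set A) = ∅ ∨
    ∃ σ : Congruence L A, (∃ a : A, (B : Set A) = {x | σ.toSetoid x a}) ∧
      ∃ (s : ℕ) (D : Fin s → Type w) (_ : ∀ i, L.Structure (D i)),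
        Nonempty (σ.Quot ≃[L] (∀ i, D i)) ∧ ∀ i, IsPCWithoutBACP L (D i)

/-- `p`-affine algebras: finite idempotent algebras with operations `⊕`, `⊖` such that
`(A; ⊕, ⊖) ≅ (ℤ_pˢ; +, -)` with `s ≥ 1`, the relation `x₁ ⊕ x₂ = x₃ ⊕ x₄` is invariant, and
`x ⊖ y ⊕ z` is a term operation. -/
def IsPAffine (L : FirstOrder.Language.{u, v}) (A : Type w) [L.Structure A] (p : ℕ) : Prop :=
  Finite A ∧ IsIdempotent L A ∧
    ∃ add sub : A → A → A,
      (∃ s : ℕ, 1 ≤ s ∧ ∃ e : A ≃ (Fin s → ZMod p),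
        (∀ x y, e (add x y) = e x + e y) ∧ (∀ x y, e (sub x y) = e x - e y)) ∧
      IsInvariant L {x : Fin 4 → A | add (x 0) (x 1) = add (x 2) (x 3)} ∧
      IsTermOperation L (fun x : Fin 3 → A => add (sub (x 0) (x 1)) (x 2))

end UnivAlg

namespace UnivAlg

open FirstOrder FirstOrder.Language FirstOrder.Language.Structure

/-! ### Strong-free simple algebras: compatible relations and polynomial interpolation. -/

section Core

variable {L : FirstOrder.Language.{u, v}} {A : Type w} [L.Structure A]

/-! Pass to the factor by a maximal proper congruence. Binary absorbing, central and projective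
subuniverses pull back, so if `A` has no nontrivial ones, the factor is simple and has none either
(`IsStrongFree`). It remains to show that such a factor is polynomially complete, in which case the
blocks are PC subuniverses, or p-affine.

Absence of projective subuniverses yields a term operation that takes every value even after any one
argument is fixed (`exists_spreading`). Through it, the left centres of a left-total compatible
relation form an absorbing subuniverse, which is central unless some neighbourhood is binary
absorbing. So one centre forces the relation to be full (`eq_univ_of_center`). With simplicity, a
compatible binary relation total on both sides is injective or full (`injective_or_univ`).

Consider compatible ternary relations in which any two coordinates extend to the third. If all of
them are full, interpolation gives polynomial completeness. Otherwise a non-full one is a Latin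
square, hence isotopic to a loop, and the spreading term makes this loop an abelian group over which
all basic operations are additive (`exists_addCommGroup`).

In the additive case the endomorphisms β with x + β(y - z) a term operation form an ideal with
respect to the coefficients of binary terms. If it is zero, every basic operation is a projection
and {0} is projective. If not, simplicity puts 1 into it (`isTranslation_one`), so x - y + z is a
term operation, and simplicity also makes the group elementary abelian. -/

/-- A binary relation preserved by every basic operation. -/
def Compatible₂ (L : FirstOrder.Language.{u, v}) {A : Type w} [L.Structure A]
    (R : A → A → Prop) : Prop :=
  ∀ (n : ℕ) (f : L.Functions n) (x y : Fin n → A), (∀ i, R (x i) (y i)) →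
    R (funMap f x) (funMap f y)

/-- A ternary relation preserved by every basic operation. -/
def Compatible₃ (L : FirstOrder.Language.{u, v}) {A : Type w} [L.Structure A]
    (R : A → A → A → Prop) : Prop :=
  ∀ (n : ℕ) (f : L.Functions n) (x y z : Fin n → A), (∀ i, R (x i) (y i) (z i)) →
    R (funMap f x) (funMap f y) (funMap f z)

theorem Compatible₂.swap {R : A → A → Prop} (h : Compatible₂ L R) :
    Compatible₂ L fun a b => R b a :=
  fun n f x y hxy => h n f y x hxy

theorem Compatible₂.comp {R S : A → A → Prop} (hR : Compatible₂ L R) (hS : Compatible₂ L S) :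
    Compatible₂ L fun a c => ∃ b, R a b ∧ S b c := by
  intro n f x y h
  choose z hz using h
  exact ⟨funMap f z, hR n f x z fun i => (hz i).1, hS n f z y fun i => (hz i).2⟩

theorem Compatible₂.term {R : A → A → Prop} (hR : Compatible₂ L R) {n : ℕ}
    {t : (Fin n → A) → A} (ht : IsTermOperation L t) {x y : Fin n → A}
    (h : ∀ i, R (x i) (y i)) : R (t x) (t y) := by
  induction ht with
  | proj i => exact h i
  | comp f hf g _ ih =>
    obtain ⟨f, rfl⟩ := hf
    exact hR _ f _ _ fun j => ih j h

theorem Compatible₃.fix (hidem : IsIdempotent L A) {R : A → A → A → Prop}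
    (hR : Compatible₃ L R) (a : A) : Compatible₂ L (R a) := by
  intro n f x y h
  have := hR n f (fun _ => a) x y h
  rwa [hidem] at this

theorem IsIdempotent.term (hidem : IsIdempotent L A) {n : ℕ} {t : (Fin n → A) → A}
    (ht : IsTermOperation L t) (a : A) : (t fun _ => a) = a := by
  induction ht with
  | proj i => rfl
  | comp f hf g _ ih =>
    obtain ⟨f, rfl⟩ := hf
    simp only [ih]
    exact hidem _ f a

theorem IsTermOperation.proj {n : ℕ} (i : Fin n) : IsTermOperation L fun x : Fin n → A => x i :=
  CloneGen.proj i

theorem IsTermOperation.basic {m n : ℕ} (f : L.Functions m) {g : Fin m → (Fin n → A) → A}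
    (hg : ∀ j, IsTermOperation L (g j)) :
    IsTermOperation L fun x => funMap f fun j => g j x :=
  CloneGen.comp (F := basicOps L A) (fun x => funMap f x) ⟨f, rfl⟩ g hg

/-- Substituting variables for the variables of a term operation. -/
theorem IsTermOperation.reindex {m n : ℕ} {t : (Fin m → A) → A} (ht : IsTermOperation L t)
    (e : Fin m → Fin n) : IsTermOperation L fun x => t fun j => x (e j) :=
  CloneGen.superpose ht fun j => CloneGen.proj (e j)

/-- An idempotent simple algebra without nontrivial binary absorbing, central and
projective subuniverses. -/
structure IsStrongFree (L : FirstOrder.Language.{u, v}) (A : Type w) [L.Structure A] : Prop where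
  idem : IsIdempotent L A
  simple : ∀ σ : Congruence L A, (∀ x y, σ.toSetoid x y → x = y) ∨ ∀ x y, σ.toSetoid x y
  binary : ∀ B : L.Substructure A, IsBinaryAbsorbing B → ¬ IsNontrivial B
  central : ∀ B : L.Substructure A, IsCentral B → ¬ IsNontrivial B
  projective : ∀ B : L.Substructure A, IsProjective B → ¬ IsNontrivial B

/-! ### A term operation without restricted values -/

/-- The composition `t (u, …, u)` with distinct variables. -/
def starComp {m n : ℕ} (t : (Fin m → A) → A) (s : (Fin n → A) → A) : (Fin (m * n) → A) → A :=
  fun x => t fun i => s fun k => x (finProdFinEquiv (i, k))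

theorem IsTermOperation.starComp {m n : ℕ} {t : (Fin m → A) → A} {s : (Fin n → A) → A}
    (ht : IsTermOperation L t) (hs : IsTermOperation L s) :
    IsTermOperation L (starComp t s) :=
  CloneGen.superpose ht fun i => hs.reindex fun k => finProdFinEquiv (i, k)

/-- The values of `t` with the `i`-th argument in `S`. -/
def valuesAt {n : ℕ} (t : (Fin n → A) → A) (i : Fin n) (S : Set A) : Set A :=
  {b | ∃ x : Fin n → A, x i ∈ S ∧ t x = b}

theorem valuesAt_mono {n : ℕ} (t : (Fin n → A) → A) (i : Fin n) {S T : Set A} (h : S ⊆ T) :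
    valuesAt t i S ⊆ valuesAt t i T :=
  fun _ ⟨x, hx, hb⟩ => ⟨x, h hx, hb⟩

theorem subset_valuesAt (hidem : IsIdempotent L A) {n : ℕ} {t : (Fin n → A) → A}
    (ht : IsTermOperation L t) (i : Fin n) (S : Set A) : S ⊆ valuesAt t i S :=
  fun a ha => ⟨fun _ => a, ha, hidem.term ht a⟩

/-- The block of variables numbered `i` realises the inner value; every other block is constant, and
idempotence collapses it to that constant. -/
theorem valuesAt_starComp (hidem : IsIdempotent L A) {m n : ℕ} {t : (Fin m → A) → A}
    {s : (Fin n → A) → A} (hs : IsTermOperation L s) (i : Fin m) (k : Fin n) (S : Set A) :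
    valuesAt t i (valuesAt s k S) ⊆ valuesAt (starComp t s) (finProdFinEquiv (i, k)) S := by
  classical
  rintro b ⟨z, ⟨y, hy, hyz⟩, rfl⟩
  refine ⟨fun p => if (finProdFinEquiv.symm p).1 = i then y (finProdFinEquiv.symm p).2
    else z (finProdFinEquiv.symm p).1, by simpa using hy, ?_⟩
  unfold starComp
  congr 1
  funext j
  by_cases h : j = i
  · subst h; simpa using hyz
  · simpa [h] using hidem.term hs (z j)

/-- For a single set `S`, a suitable basic operation exists because `S` would otherwise be a
projective subuniverse. A star composition inherits the enlarging property of both factors, so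
finitely many sets are treated one after another. -/
theorem IsStrongFree.exists_enlarging [Finite A] (hA : IsStrongFree L A) :
    ∃ (n : ℕ) (t : (Fin n → A) → A), IsTermOperation L t ∧
      ∀ S : Set A, S.Nonempty → S ≠ Set.univ → ∀ i, ¬ valuesAt t i S ⊆ S := by
  classical
  have key : ∀ 𝒮 : Finset (Set A), ∃ (n : ℕ) (t : (Fin n → A) → A), IsTermOperation L t ∧
      ∀ S ∈ 𝒮, S.Nonempty → S ≠ Set.univ → ∀ i, ¬ valuesAt t i S ⊆ S := by
    intro 𝒮
    induction 𝒮 using Finset.induction_on with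
    | empty => exact ⟨1, fun x => x 0, CloneGen.proj 0, by simp⟩
    | insert S 𝒮 _ ih =>
      obtain ⟨n, t, ht, h⟩ := ih
      by_cases hS : S.Nonempty ∧ S ≠ Set.univ
      · obtain ⟨m, f, hf⟩ : ∃ (m : ℕ) (f : L.Functions m), ∀ i : Fin m,
            ∃ x : Fin m → A, x i ∈ S ∧ funMap f x ∉ S := by
          by_contra! hcon
          -- The projectivity condition itself makes `S` closed under the operations.
          let B : L.Substructure A := ⟨S, fun {n} f x hx => by
            obtain ⟨i, hi⟩ := hcon n f
            exact hi x (hx i)⟩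
          exact hA.projective B hcon hS
        have hfT : IsTermOperation L (fun x : Fin m → A => funMap f x) :=
          CloneGen.of_mem ⟨f, rfl⟩
        refine ⟨m * n, starComp (fun x => funMap f x) t, hfT.starComp ht, ?_⟩
        intro T hT hTn hTu p hp
        obtain ⟨⟨i, k⟩, rfl⟩ := finProdFinEquiv.surjective p
        have h1 := (valuesAt_starComp hA.idem (t := fun x => funMap f x) ht i k T).trans hp
        rcases Finset.mem_insert.1 hT with rfl | hT
        · obtain ⟨x, hx, hxS⟩ := hf i
          exact hxS (h1 (valuesAt_mono _ i (subset_valuesAt hA.idem ht k T) ⟨x, hx, rfl⟩))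
        · exact h T hT hTn hTu k ((subset_valuesAt hA.idem hfT i _).trans h1)
      · refine ⟨n, t, ht, fun T hT hTn hTu => ?_⟩
        rcases Finset.mem_insert.1 hT with rfl | hT
        · exact absurd ⟨hTn, hTu⟩ hS
        · exact h T hT hTn hTu
  have := Fintype.ofFinite (Set A)
  obtain ⟨n, t, ht, h⟩ := key Finset.univ
  exact ⟨n, t, ht, fun S => h S (Finset.mem_univ S)⟩

/-- Each outer composition with the enlarging term strictly increases every value set that is not
yet full, so `Nat.card A` rounds suffice. -/
theorem IsStrongFree.exists_spreading [Finite A] (hA : IsStrongFree L A) :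
    ∃ (n : ℕ) (t : (Fin n → A) → A), IsTermOperation L t ∧
      ∀ (i : Fin n) (a b : A), ∃ x : Fin n → A, x i = a ∧ t x = b := by
  obtain ⟨m, F, hF, hgrow⟩ := hA.exists_enlarging
  have key : ∀ k : ℕ, ∃ (n : ℕ) (t : (Fin n → A) → A), IsTermOperation L t ∧
      ∀ i a, valuesAt t i {a} = Set.univ ∨ k ≤ (valuesAt t i {a}).ncard := by
    intro k
    induction k with
    | zero => exact ⟨1, fun x => x 0, CloneGen.proj 0, by simp⟩
    | succ k ih =>
      obtain ⟨n, t, ht, h⟩ := ih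
      refine ⟨m * n, starComp F t, hF.starComp ht, fun p a => ?_⟩
      obtain ⟨⟨i, j⟩, rfl⟩ := finProdFinEquiv.surjective p
      have h1 := valuesAt_starComp hA.idem (t := F) ht i j {a}
      have h2 := subset_valuesAt hA.idem hF i (valuesAt t j {a})
      by_cases hu : valuesAt t j {a} = Set.univ
      · left
        rw [hu] at h1 h2
        exact Set.univ_subset_iff.1 (h2.trans h1)
      · right
        have hne : (valuesAt t j {a}).Nonempty :=
          ⟨a, subset_valuesAt hA.idem ht j {a} rfl⟩
        have h3 : valuesAt t j {a} ⊂ valuesAt F i (valuesAt t j {a}) :=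
          ⟨h2, hgrow _ hne hu i⟩
        have h4 := Set.ncard_lt_ncard h3 (Set.toFinite _)
        have h5 := Set.ncard_le_ncard h1 (Set.toFinite _)
        rcases h j a with h | h
        · exact absurd h hu
        · omega
  obtain ⟨n, t, ht, h⟩ := key (Nat.card A)
  refine ⟨n, t, ht, fun i a b => ?_⟩
  have hu : valuesAt t i {a} = Set.univ := by
    rcases h i a with h | h
    · exact h
    · exact Set.eq_of_subset_of_ncard_le (Set.subset_univ _) (by rwa [Set.ncard_univ])
  have hb : b ∈ valuesAt t i {a} := hu ▸ Set.mem_univ b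
  exact hb

/-! ### Compatible binary relations -/

/-- The set `C` of left centres absorbs by the spreading term: a neighbour of the exceptional
argument can be prescribed, and the other arguments accept any neighbour. If (a, a) violated
centrality, the neighbourhood of `a` would be binary absorbing. Hence `C` is central and must be
everything. -/
theorem IsStrongFree.eq_univ_of_center [Finite A] [Nontrivial A] (hA : IsStrongFree L A)
    {R : A → A → Prop} (hR : Compatible₂ L R) (htot : ∀ a, ∃ b, R a b)
    {c : A} (hc : ∀ b, R c b) : ∀ a b, R a b := by
  obtain ⟨n, t, ht, hspread⟩ := hA.exists_spreading
  let C : L.Substructure A := ⟨{a | ∀ b, R a b}, fun {n} f x hx b => by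
    have := hR n f x (fun _ => b) fun i => hx i b
    rwa [hA.idem] at this⟩
  -- A nullary idempotent term would force all elements to be equal.
  have hn : 0 < n := by
    rcases Nat.eq_zero_or_pos n with rfl | h
    · obtain ⟨a, b, hab⟩ := exists_pair_ne A
      refine absurd ?_ hab
      rw [← hA.idem.term ht a, ← hA.idem.term ht b]
      exact congrArg t (Subsingleton.elim _ _)
    · exact h
  have habs : IsAbsorbing C := by
    refine ⟨n, t, hn, ht, fun i x hx b => ?_⟩
    obtain ⟨d, hd⟩ := htot (x i)
    obtain ⟨y, hy, rfl⟩ := hspread i d b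
    refine hR.term ht fun j => ?_
    by_cases hj : j = i
    · subst hj; rwa [hy]
    · exact hx j hj (y j)
  have hcen : IsCentral C := by
    refine ⟨habs, fun a ha hmem => ?_⟩
    -- Each generated pair carries a binary term sending the neighbourhood of `a`, placed in either
    -- argument, into the neighbourhood of the corresponding entry. The generators use the two
    -- projections. At (a, a) this is binary absorption.
    have key : ∀ z ∈ Substructure.closure L (crossPairs C a),
        ∃ s : (Fin 2 → A) → A, IsTermOperation L s ∧
          (∀ y : Fin 2 → A, R a (y 0) → R (z 0) (s y)) ∧
          (∀ y : Fin 2 → A, R a (y 1) → R (z 1) (s y)) := by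
      intro z hz
      refine Substructure.closure_induction hz ?_ fun {n} f x hx => ?_
      · change ∀ i, ∃ s, _ at hx
        choose s hs h0 h1 using hx
        exact ⟨_, IsTermOperation.basic f hs,
          fun y hy => hR n f _ _ fun i => h0 i y hy, fun y hy => hR n f _ _ fun i => h1 i y hy⟩
      · rintro z (⟨h0, h1⟩ | ⟨h0, h1⟩)
        · exact ⟨fun y => y 0, CloneGen.proj 0, fun y hy => h0 ▸ hy, fun y _ => h1 _⟩
        · exact ⟨fun y => y 1, CloneGen.proj 1, fun y _ => h0 _, fun y hy => h1 ▸ hy⟩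
    obtain ⟨s, hs, h0, h1⟩ := key _ hmem
    let D : L.Substructure A := ⟨{b | R a b}, fun {n} f x hx => by
      have := hR n f (fun _ => a) x hx
      rwa [hA.idem] at this⟩
    refine hA.binary D ⟨s, hs, fun i y hy => ?_⟩ ⟨htot a, fun hu => ha fun b => ?_⟩
    · fin_cases i
      · exact h1 y (hy 1 (by simp))
      · exact h0 y (hy 0 (by simp))
    · have : b ∈ (D : Set A) := hu ▸ Set.mem_univ b
      exact this
  have hCu : (C : Set A) = Set.univ := by
    by_contra hne
    exact hA.central C hcen ⟨⟨c, hc⟩, hne⟩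
  intro a
  have : a ∈ (C : Set A) := hCu ▸ Set.mem_univ a
  exact this

/-- Common neighbours of pairs are upgraded to a common neighbour of all elements, which is a centre
of the converse relation. In the upgrade, `x` is fixed: having a neighbour in common with `x` and
`T` is a compatible relation between `y` and `z` with centre `x`. -/
theorem IsStrongFree.eq_univ_of_common_neighbor [Finite A] [Nontrivial A]
    (hA : IsStrongFree L A) {R : A → A → Prop} (hR : Compatible₂ L R)
    (hright : ∀ b, ∃ a, R a b) (hcommon : ∀ x y, ∃ b, R x b ∧ R y b) : ∀ a b, R a b := by
  classical
  have key : ∀ (T : Finset A) (x y : A), ∃ b, R x b ∧ R y b ∧ ∀ a ∈ T, R a b := by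
    intro T
    induction T using Finset.induction_on with
    | empty => simpa using hcommon
    | insert z T _ ih =>
      intro x y
      have hcomp : Compatible₂ L fun y z => ∃ b, R x b ∧ R y b ∧ R z b ∧ ∀ a ∈ T, R a b := by
        intro n f y z h
        choose b hb using h
        refine ⟨funMap f b, ?_, hR n f _ _ fun i => (hb i).2.1,
          hR n f _ _ fun i => (hb i).2.2.1, fun a ha => ?_⟩
        · have := hR n f (fun _ => x) b fun i => (hb i).1
          rwa [hA.idem] at this
        · have := hR n f (fun _ => a) b fun i => (hb i).2.2.2 a ha
          rwa [hA.idem] at this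
      obtain ⟨b, h1, h2, h3, h4⟩ := hA.eq_univ_of_center hcomp (c := x)
        (fun y => by
          obtain ⟨b, h1, h2, h3⟩ := ih x y
          exact ⟨x, b, h1, h2, h1, h3⟩)
        (fun z => by
          obtain ⟨b, h1, h2, h3⟩ := ih x z
          exact ⟨b, h1, h1, h2, h3⟩) y z
      exact ⟨b, h1, h2, fun a ha => by
        rcases Finset.mem_insert.1 ha with rfl | ha
        exacts [h3, h4 a ha]⟩
  have := Fintype.ofFinite A
  obtain ⟨x⟩ : Nonempty A := inferInstance
  obtain ⟨b, -, -, hb⟩ := key Finset.univ x x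
  intro a c
  exact hA.eq_univ_of_center hR.swap hright (c := b) (fun a => hb a (Finset.mem_univ a)) c a

/-- A transitive tolerance is a congruence. A non-transitive one has a strictly larger square, which
by induction on the number of missing pairs is full; this says that any two elements have a common
neighbour. -/
theorem IsStrongFree.eq_or_univ_of_tolerance [Finite A] [Nontrivial A] (hA : IsStrongFree L A)
    {S : A → A → Prop} (hS : Compatible₂ L S) (hrefl : ∀ a, S a a)
    (hsymm : ∀ a b, S a b → S b a) : (∀ a b, S a b → a = b) ∨ ∀ a b, S a b := by
  induction hk : ({p : A × A | ¬ S p.1 p.2}).ncard using Nat.strong_induction_on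
    generalizing S with
  | _ k ih =>
  subst hk
  by_cases htrans : ∀ a b c, S a b → S b c → S a c
  · exact hA.simple ⟨⟨S, hrefl, fun h => hsymm _ _ h, fun h h' => htrans _ _ _ h h'⟩,
      fun f x y h => hS _ f x y h⟩
  · push Not at htrans
    obtain ⟨a, b, c, hab, hbc, hac⟩ := htrans
    have hsub : ∀ x y, S x y → ∃ z, S x z ∧ S z y := fun x y h => ⟨x, hrefl x, h⟩
    have hlt : ({p : A × A | ¬ ∃ z, S p.1 z ∧ S z p.2}).ncard <
        ({p : A × A | ¬ S p.1 p.2}).ncard := by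
      refine Set.ncard_lt_ncard ⟨fun p hp h => hp (hsub _ _ h), fun h => ?_⟩ (Set.toFinite _)
      exact h (show (a, c) ∈ {p : A × A | ¬ S p.1 p.2} from hac) ⟨b, hab, hbc⟩
    rcases ih _ hlt (hS.comp hS) (fun a => ⟨a, hrefl a, hrefl a⟩)
      (fun a b ⟨z, h1, h2⟩ => ⟨z, hsymm _ _ h2, hsymm _ _ h1⟩) rfl with h | h
    · exact absurd (h a c ⟨b, hab, hbc⟩ ▸ hrefl a) hac
    · right
      refine hA.eq_univ_of_common_neighbor hS (fun b => ⟨b, hrefl b⟩) fun x y => ?_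
      obtain ⟨z, h1, h2⟩ := h x y
      exact ⟨z, h1, hsymm _ _ h2⟩

theorem IsStrongFree.injective_or_univ [Finite A] [Nontrivial A] (hA : IsStrongFree L A)
    {R : A → A → Prop} (hR : Compatible₂ L R) (hleft : ∀ a, ∃ b, R a b)
    (hright : ∀ b, ∃ a, R a b) :
    (∀ a a' b, R a b → R a' b → a = a') ∨ ∀ a b, R a b := by
  rcases hA.eq_or_univ_of_tolerance (hR.comp hR.swap)
    (fun a => (hleft a).imp fun b h => ⟨h, h⟩) (fun a b ⟨z, h1, h2⟩ => ⟨z, h2, h1⟩) with h | h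
  · exact Or.inl fun a a' b h1 h2 => h a a' ⟨b, h1, h2⟩
  · exact Or.inr (hA.eq_univ_of_common_neighbor hR hright h)

theorem IsStrongFree.eq_or_univ_of_refl [Finite A] [Nontrivial A] (hA : IsStrongFree L A)
    {R : A → A → Prop} (hR : Compatible₂ L R) (hrefl : ∀ a, R a a) :
    (∀ a b, R a b → a = b) ∨ ∀ a b, R a b := by
  rcases hA.injective_or_univ hR (fun a => ⟨a, hrefl a⟩) (fun a => ⟨a, hrefl a⟩) with h | h
  · exact Or.inl fun a b hab => h a b b hab (hrefl b)
  · exact Or.inr h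

/-! ### Compatible ternary relations -/

/-- Each row `Q x` is injective or full. A failure of cancellation makes one row full, which gives a
centre of the section at `z`. That section is then full, so no row is injective and `Q` is full. -/
theorem IsStrongFree.ternary_cancel [Finite A] [Nontrivial A] (hA : IsStrongFree L A)
    {Q : A → A → A → Prop} (hQ : Compatible₃ L Q)
    (h12 : ∀ x y, ∃ z, Q x y z) (h13 : ∀ x z, ∃ y, Q x y z)
    (hne : ¬ ∀ x y z, Q x y z) {x y y' z : A} (h : Q x y z) (h' : Q x y' z) : y = y' := by
  by_contra hyy
  have hrow : ∀ x, (∀ y z, Q x y z) ∨ ∀ y y' z, Q x y z → Q x y' z → y = y' := fun x =>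
    (hA.injective_or_univ (hQ.fix hA.idem x) (h12 x) (h13 x)).symm
  have hx : ∀ y z, Q x y z := (hrow x).resolve_right fun hi => hyy (hi y y' z h h')
  have hall : ∀ x y, Q x y z := by
    refine hA.eq_univ_of_center (R := fun x y => Q x y z) (c := x) ?_ (fun x => h13 x z)
      (fun y => hx y z)
    intro n f x y h
    have := hQ n f x y (fun _ => z) h
    rwa [hA.idem] at this
  exact hne fun x => (hrow x).resolve_right fun hi => hyy (hi y y' z (hall x y) (hall x y'))

/-- Interpolation on finite sets of points, by induction. On two points, the value pairs of
polynomials form a reflexive relation that is not equality, since distinct points differ in a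
coordinate. -/
theorem IsStrongFree.isPolynomiallyComplete [Finite A] [Nontrivial A] (hA : IsStrongFree L A)
    (h3 : ∀ Q : A → A → A → Prop, Compatible₃ L Q → (∀ x y, ∃ z, Q x y z) →
      (∀ x z, ∃ y, Q x y z) → (∀ y z, ∃ x, Q x y z) → ∀ x y z, Q x y z) :
    IsPolynomiallyComplete L A := by
  classical
  intro n g
  set P : ((Fin n → A) → A) → Prop := fun f => CloneGen (fun k => basicOps L A k ∪ constOps A k) f
  have hP : ∀ {m : ℕ} (f : L.Functions m) (r : Fin m → (Fin n → A) → A), (∀ i, P (r i)) →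
      P fun x => funMap f fun i => r i x :=
    fun f r hr => CloneGen.comp (fun x => funMap f x) (Or.inl ⟨f, rfl⟩) r hr
  have hconst : ∀ a, P fun _ => a := fun a =>
    CloneGen.comp (m := 0) (fun _ => a) (Or.inr ⟨a, rfl⟩) (fun i => i.elim0) fun i => i.elim0
  have h2 : ∀ p q : Fin n → A, p ≠ q → ∀ a b, ∃ r, P r ∧ r p = a ∧ r q = b := by
    intro p q hpq
    have hcomp : Compatible₂ L fun a b => ∃ r, P r ∧ r p = a ∧ r q = b := by
      intro m f x y h
      choose r hr using h
      refine ⟨_, hP f r fun i => (hr i).1, ?_, ?_⟩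
      · exact congrArg _ (funext fun i => (hr i).2.1)
      · exact congrArg _ (funext fun i => (hr i).2.2)
    refine (hA.eq_or_univ_of_refl hcomp fun a => ⟨_, hconst a, rfl, rfl⟩).resolve_left fun he => ?_
    exact hpq (funext fun i => he (p i) (q i) ⟨_, CloneGen.proj i, rfl, rfl⟩)
  have key : ∀ (T : Finset (Fin n → A)) (g : (Fin n → A) → A), ∃ r, P r ∧ ∀ p ∈ T, r p = g p := by
    intro T
    induction T using Finset.strongInduction with
    | H T ih =>
    intro g
    by_cases hT : T.card ≤ 2
    · obtain ⟨p, q, hpq⟩ : ∃ p q, T ⊆ {p, q} := by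
        rcases Nat.lt_or_ge T.card 1 with h | h
        · have : T = ∅ := Finset.card_eq_zero.1 (by omega)
          obtain ⟨a⟩ : Nonempty A := inferInstance
          exact ⟨fun _ => a, fun _ => a, by simp [this]⟩
        · rcases Nat.lt_or_ge T.card 2 with h' | h'
          · obtain ⟨p, rfl⟩ := Finset.card_eq_one.1 (show T.card = 1 by omega)
            exact ⟨p, p, by simp⟩
          · obtain ⟨p, q, -, rfl⟩ := Finset.card_eq_two.1 (show T.card = 2 by omega)
            exact ⟨p, q, subset_rfl⟩
      have : ∃ r, P r ∧ r p = g p ∧ r q = g q := by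
        by_cases h : p = q
        · subst h
          exact ⟨_, hconst (g p), rfl, rfl⟩
        · exact h2 p q h _ _
      obtain ⟨r, hr, hrp, hrq⟩ := this
      refine ⟨r, hr, fun s hs => ?_⟩
      have := hpq hs
      rw [Finset.mem_insert, Finset.mem_singleton] at this
      rcases this with rfl | rfl
      exacts [hrp, hrq]
    · obtain ⟨p, hp, q, hq, s, hs, hpq, hps, hqs⟩ := Finset.two_lt_card.1 (not_le.1 hT)
      have hsome : ∀ t ∈ T, ∀ g : (Fin n → A) → A, ∃ r, P r ∧ ∀ u ∈ T, u ≠ t → r u = g u := by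
        intro t ht g
        obtain ⟨r, hr, h⟩ := ih (T.erase t) (Finset.erase_ssubset ht) g
        exact ⟨r, hr, fun u hu hut => h u (Finset.mem_erase.2 ⟨hut, hu⟩)⟩
      -- Three points are left free and the values elsewhere on `T` are prescribed. Dropping one of
      -- the three points and interpolating on the rest gives the extension hypotheses of `h3`.
      have hall := h3 (fun x y z => ∃ r, P r ∧ r p = x ∧ r q = y ∧ r s = z ∧
          ∀ u ∈ T, u ≠ p → u ≠ q → u ≠ s → r u = g u)
        (by
          intro m f x y z h
          choose r hr using h
          refine ⟨_, hP f r fun i => (hr i).1, ?_, ?_, ?_, fun u hu h1 h2 h3 => ?_⟩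
          · exact congrArg _ (funext fun i => (hr i).2.1)
          · exact congrArg _ (funext fun i => (hr i).2.2.1)
          · exact congrArg _ (funext fun i => (hr i).2.2.2.1)
          · rw [← hA.idem m f (g u)]
            exact congrArg _ (funext fun i => (hr i).2.2.2.2 u hu h1 h2 h3))
        (by
          intro x y
          obtain ⟨r, hr, h⟩ := hsome s hs fun u => if u = p then x else if u = q then y else g u
          refine ⟨r s, r, hr, ?_, ?_, rfl, fun u hu h1 h2 h3 => ?_⟩
          · simp [h p hp hps]
          · simp [h q hq hqs, hpq.symm]
          · simp [h u hu h3, h1, h2])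
        (by
          intro x z
          obtain ⟨r, hr, h⟩ := hsome q hq fun u => if u = p then x else if u = s then z else g u
          refine ⟨r q, r, hr, ?_, rfl, ?_, fun u hu h1 h2 h3 => ?_⟩
          · simp [h p hp hpq]
          · simp [h s hs hqs.symm, hps.symm]
          · simp [h u hu h2, h1, h3])
        (by
          intro y z
          obtain ⟨r, hr, h⟩ := hsome p hp fun u => if u = q then y else if u = s then z else g u
          refine ⟨r p, r, hr, rfl, ?_, ?_, fun u hu h1 h2 h3 => ?_⟩
          · simp [h q hq hpq.symm]
          · simp [h s hs hps.symm, hqs.symm]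
          · simp [h u hu h1, h2, h3])
        (g p) (g q) (g s)
      obtain ⟨r, hr, hrp, hrq, hrs, h⟩ := hall
      refine ⟨r, hr, fun u hu => ?_⟩
      by_cases h1 : u = p
      · rw [h1, hrp]
      by_cases h2 : u = q
      · rw [h2, hrq]
      by_cases h3 : u = s
      · rw [h3, hrs]
      exact h u hu h1 h2 h3
  have := Fintype.ofFinite (Fin n → A)
  obtain ⟨r, hr, h⟩ := key Finset.univ g
  have : r = g := funext fun p => h p (Finset.mem_univ p)
  exact this ▸ hr

end Core
section Affine

variable {L : FirstOrder.Language.{u, v}} {A : Type w} [L.Structure A]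

/-! ### From compatible Latin squares to abelian groups -/

/-- A compatible Latin square yields a loop whose graph is compatible. -/
theorem exists_loop [Finite A] [Nonempty A] (hidem : IsIdempotent L A) {Q : A → A → A → Prop}
    (hQ : Compatible₃ L Q) (h12 : ∀ x y, ∃ z, Q x y z)
    (h1 : ∀ {x x' y z}, Q x y z → Q x' y z → x = x')
    (h2 : ∀ {x y y' z}, Q x y z → Q x y' z → y = y')
    (h3 : ∀ {x y z z'}, Q x y z → Q x y z' → z = z') :
    ∃ (add : A → A → A) (zero : A),
      (∀ (n : ℕ) (f : L.Functions n) (x y : Fin n → A),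
        funMap f (fun i => add (x i) (y i)) = add (funMap f x) (funMap f y)) ∧
      (∀ x, add zero x = x) ∧ (∀ x, add x zero = x) ∧ ∀ x, ∃ y, add y x = zero := by
  choose m hm using h12
  have hmf : ∀ (n : ℕ) (f : L.Functions n) (x y : Fin n → A),
      funMap f (fun i => m (x i) (y i)) = m (funMap f x) (funMap f y) := fun n f x y =>
    h3 (hQ n f _ _ _ fun i => hm (x i) (y i)) (hm _ _)
  have hml : ∀ y, Function.Bijective fun x => m x y := fun y =>
    Finite.injective_iff_bijective.1 fun a b (hab : m a y = m b y) =>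
      h1 (hm a y) (hab ▸ hm b y)
  have hmr : ∀ x, Function.Bijective fun y => m x y := fun x =>
    Finite.injective_iff_bijective.1 fun a b (hab : m x a = m x b) =>
      h2 (hm x a) (hab ▸ hm x b)
  obtain ⟨e⟩ : Nonempty A := inferInstance
  let l := Equiv.ofBijective _ (hml e)
  let r := Equiv.ofBijective _ (hmr e)
  have hl : ∀ x, l x = m x e := fun _ => rfl
  have hr : ∀ y, r y = m e y := fun _ => rfl
  have hlf : ∀ (n : ℕ) (f : L.Functions n) (x : Fin n → A),
      l.symm (funMap f x) = funMap f fun i => l.symm (x i) := by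
    intro n f x
    have h := hmf n f (fun i => l.symm (x i)) fun _ => e
    rw [hidem] at h
    rw [Equiv.symm_apply_eq, hl, ← h]
    exact congrArg _ (funext fun i => (l.apply_symm_apply (x i)).symm)
  have hrf : ∀ (n : ℕ) (f : L.Functions n) (x : Fin n → A),
      r.symm (funMap f x) = funMap f fun i => r.symm (x i) := by
    intro n f x
    have h := hmf n f (fun _ => e) fun i => r.symm (x i)
    rw [hidem] at h
    rw [Equiv.symm_apply_eq, hr, ← h]
    exact congrArg _ (funext fun i => (r.apply_symm_apply (x i)).symm)
  have hle : l.symm (m e e) = e := l.symm_apply_eq.2 (hl e).symm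
  have hre : r.symm (m e e) = e := r.symm_apply_eq.2 (hr e).symm
  -- The principal isotope of `m` at `e`; the translations by `e` commute with the operations
  -- because `e` is idempotent.
  refine ⟨fun x y => m (l.symm x) (r.symm y), m e e, ?_, ?_, ?_, ?_⟩
  · intro n f x y
    simp only [hmf, hlf, hrf]
  · intro x
    simp only [hle]
    exact r.apply_symm_apply x
  · intro x
    simp only [hre]
    exact l.apply_symm_apply x
  · intro x
    obtain ⟨y, hy⟩ := (hml (r.symm x)).2 (m e e)
    exact ⟨l y, by simpa using hy⟩

theorem IsTermOperation.map_add {add : A → A → A}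
    (hadd : ∀ (n : ℕ) (f : L.Functions n) (x y : Fin n → A),
        funMap f (fun i => add (x i) (y i)) = add (funMap f x) (funMap f y))
    {n : ℕ} {t : (Fin n → A) → A} (ht : IsTermOperation L t) (x y : Fin n → A) :
    t (fun i => add (x i) (y i)) = add (t x) (t y) := by
  induction ht with
  | proj i => rfl
  | comp f hf g _ ih =>
    obtain ⟨f, rfl⟩ := hf
    simp only [ih]
    exact hadd _ f _ _

/-- A compatible loop on an algebra with a spreading term operation is an abelian group. -/
theorem loop_comm_assoc (hidem : IsIdempotent L A) {n : ℕ} {t : (Fin n → A) → A}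
    (ht : IsTermOperation L t) (hspread : ∀ (i : Fin n) (a b : A), ∃ x, x i = a ∧ t x = b)
    {add : A → A → A} {zero : A}
    (hadd : ∀ (n : ℕ) (f : L.Functions n) (x y : Fin n → A),
        funMap f (fun i => add (x i) (y i)) = add (funMap f x) (funMap f y))
    (h0 : ∀ x, add zero x = x) (h0' : ∀ x, add x zero = x) :
    (∀ x y, add x y = add y x) ∧ ∀ x y z, add (add x y) z = add x (add y z) := by
  classical
  -- The centre of the loop: elements that commute, and associate in every position.
  let N : A → Prop := fun z => ∀ u w, add z u = add u z ∧ add z (add u w) = add (add z u) w ∧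
    add (add u z) w = add u (add z w) ∧ add (add u w) z = add u (add w z)
  have htadd := ht.map_add hadd
  have ht0 : t (fun _ => zero) = zero := hidem.term ht zero
  have hN0 : N zero := fun u w => by simp only [h0, h0', and_self]
  have hNadd : ∀ {z z'}, N z → N z' → N (add z z') := by
    intro z z' hz hz' u w
    refine ⟨?_, ?_, ?_, ?_⟩
    · rw [← (hz z' u).2.1, (hz' u u).1, (hz u z').2.1, (hz u u).1, (hz u z').2.2.1]
    · rw [← (hz z' (add u w)).2.1, (hz' u w).2.1, (hz (add z' u) w).2.1, (hz z' u).2.1]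
    · rw [← (hz u z').2.2.1, (hz' (add u z) w).2.2.1, (hz u (add z' w)).2.2.1, (hz z' w).2.1]
    · rw [← (hz' (add u w) z).2.2.2, (hz u w).2.2.2, (hz' u (add w z)).2.2.2,
        (hz' w z).2.2.2]
  -- Spreading writes `u` and `w` as values of `t` with zero at `i`. In each coordinate the required
  -- identities then involve a zero and are trivial.
  have hNs : ∀ (i : Fin n) (v : A), N (t (Function.update (fun _ => zero) i v)) := by
    intro i v u w
    obtain ⟨x, hx, rfl⟩ := hspread i zero u
    obtain ⟨y, hy, rfl⟩ := hspread i zero w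
    simp only [← htadd]
    refine ⟨congrArg t ?_, congrArg t ?_, congrArg t ?_, congrArg t ?_⟩ <;>
    · funext j
      by_cases hj : j = i
      · subst hj; simp [hx, hy, h0, h0']
      · simp [Function.update_of_ne hj, h0, h0']
  have hNt : ∀ (x : Fin n → A) (s : Finset (Fin n)), N (t fun j => if j ∈ s then x j else zero) := by
    intro x s
    induction s using Finset.induction_on with
    | empty => simpa [ht0] using hN0
    | insert i s hi ih =>
      have : (fun j => if j ∈ insert i s then x j else zero) = fun j =>
          add (Function.update (fun _ => zero) i (x i) j) (if j ∈ s then x j else zero) := by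
        funext j
        by_cases hj : j = i
        · subst hj; simp [hi, h0']
        · simp [hj, h0]
      rw [this, htadd]
      exact hNadd (hNs i (x i)) ih
  -- By idempotence z = t(z, …, z), which additivity splits into the central one-variable parts.
  have hN : ∀ z, N z := fun z => by
    have := hNt (fun _ => z) Finset.univ
    simpa [hidem.term ht z] using this
  exact ⟨fun x y => (hN x y y).1, fun x y z => (hN x y z).2.1.symm⟩

theorem IsStrongFree.exists_addCommGroup [Finite A] [Nontrivial A] (hA : IsStrongFree L A)
    {Q : A → A → A → Prop} (hQ : Compatible₃ L Q)
    (h12 : ∀ x y, ∃ z, Q x y z) (h13 : ∀ x z, ∃ y, Q x y z) (h23 : ∀ y z, ∃ x, Q x y z)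
    (hne : ¬ ∀ x y z, Q x y z) :
    ∃ _ : AddCommGroup A, ∀ (n : ℕ) (f : L.Functions n) (x y : Fin n → A),
      funMap f (fun i => x i + y i) = funMap f x + funMap f y := by
  obtain ⟨add, zero, hadd, h0, h0', hneg⟩ := exists_loop hA.idem hQ h12
    (fun {x x' y z} h h' => hA.ternary_cancel (Q := fun y x z => Q x y z)
      (fun n f x y z h => hQ n f y x z h) (fun y x => h12 x y) h23
      (fun h => hne fun x y z => h y x z) h h')
    (fun {x y y' z} h h' => hA.ternary_cancel hQ h12 h13 hne h h')
    (fun {x y z z'} h h' => hA.ternary_cancel (Q := fun x z y => Q x y z)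
      (fun n f x y z h => hQ n f x z y h) h13 h12 (fun h => hne fun x y z => h x z y) h h')
  obtain ⟨n, t, ht, hspread⟩ := hA.exists_spreading
  obtain ⟨hcomm, hassoc⟩ := loop_comm_assoc hA.idem ht hspread hadd h0 h0'
  choose neg hneg using hneg
  let _ : Add A := ⟨add⟩
  let _ : Zero A := ⟨zero⟩
  let _ : Neg A := ⟨neg⟩
  let _ : AddGroup A := AddGroup.ofLeftAxioms hassoc h0 hneg
  exact ⟨{ add_comm := hcomm }, hadd⟩

/-! ### Coefficients of term operations -/

theorem IsTermOperation.binary {n : ℕ} {b : A → A → A}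
    (hb : IsTermOperation L fun x : Fin 2 → A => b (x 0) (x 1)) {g h : (Fin n → A) → A}
    (hg : IsTermOperation L g) (hh : IsTermOperation L h) :
    IsTermOperation L fun x => b (g x) (h x) :=
  CloneGen.superpose (g := ![g, h]) hb fun j => by fin_cases j <;> assumption

theorem IsTermOperation.ternary {n : ℕ} {b : A → A → A → A}
    (hb : IsTermOperation L fun x : Fin 3 → A => b (x 0) (x 1) (x 2))
    {g h k : (Fin n → A) → A} (hg : IsTermOperation L g) (hh : IsTermOperation L h)
    (hk : IsTermOperation L k) : IsTermOperation L fun x => b (g x) (h x) (k x) :=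
  CloneGen.superpose (g := ![g, h, k]) hb fun j => by fin_cases j <;> assumption

variable [AddCommGroup A]

theorem end_mul_apply (β γ : AddMonoid.End A) (a : A) : (β * γ) a = β (γ a) := rfl

theorem end_add_apply (β γ : AddMonoid.End A) (a : A) : (β + γ) a = β a + γ a := rfl

theorem end_neg_apply (β : AddMonoid.End A) (a : A) : (-β) a = -β a := rfl

theorem end_sub_apply (β γ : AddMonoid.End A) (a : A) : (β - γ) a = β a - γ a :=
  AddMonoidHom.sub_apply β γ a

theorem end_one_apply (a : A) : (1 : AddMonoid.End A) a = a := rfl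

/-- The endomorphisms `β` for which `β x + (1 - β) y` is a term operation. -/
def IsCoefficient (L : FirstOrder.Language.{u, v}) {A : Type w} [L.Structure A] [AddCommGroup A]
    (β : AddMonoid.End A) : Prop :=
  IsTermOperation L fun x : Fin 2 → A => β (x 0 - x 1) + x 1

/-- The endomorphisms `β` for which `x + β (y - z)` is a term operation. -/
def IsTranslation (L : FirstOrder.Language.{u, v}) {A : Type w} [L.Structure A] [AddCommGroup A]
    (β : AddMonoid.End A) : Prop :=
  IsTermOperation L fun x : Fin 3 → A => x 0 + β (x 1 - x 2)

theorem IsCoefficient.apply {β : AddMonoid.End A} (hβ : IsCoefficient L β) {n : ℕ}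
    {g h : (Fin n → A) → A} (hg : IsTermOperation L g) (hh : IsTermOperation L h) :
    IsTermOperation L fun x => β (g x - h x) + h x :=
  IsTermOperation.binary (b := fun x y => β (x - y) + y) hβ hg hh

theorem IsTranslation.apply {β : AddMonoid.End A} (hβ : IsTranslation L β) {n : ℕ}
    {g h k : (Fin n → A) → A} (hg : IsTermOperation L g) (hh : IsTermOperation L h)
    (hk : IsTermOperation L k) : IsTermOperation L fun x => g x + β (h x - k x) :=
  IsTermOperation.ternary (b := fun x y z => x + β (y - z)) hβ hg hh hk

theorem IsCoefficient.one : IsCoefficient L (1 : AddMonoid.End A) := by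
  have := IsTermOperation.proj (L := L) (A := A) (0 : Fin 2)
  unfold IsCoefficient
  convert this using 2
  simp

theorem IsCoefficient.combine {β γ δ : AddMonoid.End A} (hβ : IsCoefficient L β)
    (hγ : IsCoefficient L γ) (hδ : IsCoefficient L δ) :
    IsCoefficient L (β * (γ - δ) + δ) := by
  have := hβ.apply hγ hδ
  unfold IsCoefficient
  convert this using 2
  simp only [end_add_apply, end_mul_apply, end_sub_apply, map_sub, map_add]
  abel

theorem IsCoefficient.one_sub {β : AddMonoid.End A} (hβ : IsCoefficient L β) :
    IsCoefficient L (1 - β) := by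
  have := hβ.apply (IsTermOperation.proj (L := L) (A := A) (1 : Fin 2)) (IsTermOperation.proj 0)
  unfold IsCoefficient
  convert this using 2
  simp only [end_sub_apply, end_one_apply, map_sub]
  abel

theorem IsCoefficient.zero : IsCoefficient L (0 : AddMonoid.End A) := by
  simpa using (IsCoefficient.one (L := L) (A := A)).one_sub

theorem IsCoefficient.mul {β γ : AddMonoid.End A} (hβ : IsCoefficient L β)
    (hγ : IsCoefficient L γ) : IsCoefficient L (β * γ) := by
  simpa using hβ.combine hγ IsCoefficient.zero

theorem IsCoefficient.pow {β : AddMonoid.End A} (hβ : IsCoefficient L β) (n : ℕ) :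
    IsCoefficient L (β ^ n) := by
  induction n with
  | zero => simpa using IsCoefficient.one
  | succ n ih => rw [pow_succ]; exact ih.mul hβ

theorem IsTranslation.zero : IsTranslation L (0 : AddMonoid.End A) := by
  have := IsTermOperation.proj (L := L) (A := A) (0 : Fin 3)
  unfold IsTranslation
  convert this using 2
  simp

theorem IsTranslation.neg {β : AddMonoid.End A} (hβ : IsTranslation L β) :
    IsTranslation L (-β) := by
  have := hβ.apply (IsTermOperation.proj (L := L) (A := A) (0 : Fin 3)) (IsTermOperation.proj 2)
    (IsTermOperation.proj 1)
  unfold IsTranslation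
  convert this using 2
  simp [end_neg_apply]

theorem IsTranslation.add {β γ : AddMonoid.End A} (hβ : IsTranslation L β)
    (hγ : IsTranslation L γ) : IsTranslation L (β + γ) := by
  have := hγ.apply hβ (IsTermOperation.proj (L := L) (A := A) (1 : Fin 3)) (IsTermOperation.proj 2)
  unfold IsTranslation
  convert this using 2
  simp only [end_add_apply, add_assoc]

theorem IsTranslation.isCoefficient {β : AddMonoid.End A} (hβ : IsTranslation L β) :
    IsCoefficient L β := by
  have := hβ.apply (IsTermOperation.proj (L := L) (A := A) (1 : Fin 2)) (IsTermOperation.proj 0)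
    (IsTermOperation.proj 1)
  unfold IsCoefficient
  convert this using 2
  rw [add_comm]

/-- The base point of the two substituted binary terms cancels in their difference. Together with
`IsCoefficient.mul_translation` this is the two-sided ideal property. -/
theorem IsTranslation.mul_coefficient {β γ : AddMonoid.End A} (hβ : IsTranslation L β)
    (hγ : IsCoefficient L γ) : IsTranslation L (β * γ) := by
  have h0 := IsTermOperation.proj (L := L) (A := A) (0 : Fin 3)
  have := hβ.apply h0 (hγ.apply (IsTermOperation.proj 1) h0) (hγ.apply (IsTermOperation.proj 2) h0)
  unfold IsTranslation
  convert this using 2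
  simp

theorem IsCoefficient.mul_translation {β γ : AddMonoid.End A} (hγ : IsCoefficient L γ)
    (hβ : IsTranslation L β) : IsTranslation L (γ * β) := by
  have := hγ.apply hβ (IsTermOperation.proj (L := L) (A := A) (0 : Fin 3))
  unfold IsTranslation
  convert this using 2
  simp [add_comm]

theorem IsTranslation.pow {β : AddMonoid.End A} (hβ : IsTranslation L β) {n : ℕ} (hn : n ≠ 0) :
    IsTranslation L (β ^ n) := by
  obtain ⟨k, rfl⟩ := Nat.exists_eq_succ_of_ne_zero hn
  rw [Nat.succ_eq_add_one, pow_succ']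
  exact hβ.mul_coefficient (hβ.isCoefficient.pow k)

/-- Expand γ(β(x - y) + y - z) + z using γβ = 1: the result is x + (γ - 1)(y - z). -/
theorem IsCoefficient.isTranslation_of_mul_eq_one {β γ : AddMonoid.End A}
    (hβ : IsCoefficient L β) (hγ : IsCoefficient L γ) (h : γ * β = 1) :
    IsTranslation L (γ - 1) := by
  have := hγ.apply (hβ.apply (IsTermOperation.proj (L := L) (A := A) (0 : Fin 3)) (IsTermOperation.proj 1))
    (IsTermOperation.proj 2)
  unfold IsTranslation
  convert this using 2 with x
  have h' : ∀ a, γ (β a) = a := fun a => DFunLike.congr_fun h a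
  simp only [end_sub_apply, end_one_apply, map_sub, map_add, h']
  abel

theorem exists_pow_isIdempotentElem {M : Type*} [Monoid M] [Finite M] (a : M) :
    ∃ n, n ≠ 0 ∧ IsIdempotentElem (a ^ n) := by
  obtain ⟨m, n, hmn, h⟩ : ∃ m n, m < n ∧ a ^ m = a ^ n := by
    obtain ⟨m, n, hne, h⟩ := Finite.exists_ne_map_eq_of_infinite fun n : ℕ => a ^ n
    rcases lt_or_gt_of_ne hne with hlt | hlt
    exacts [⟨m, n, hlt, h⟩, ⟨n, m, hlt, h.symm⟩]
  obtain ⟨d, rfl⟩ := Nat.exists_eq_add_of_lt hmn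
  have hper : ∀ j k, m ≤ k → a ^ (k + j * (d + 1)) = a ^ k := by
    intro j
    induction j with
    | zero => simp
    | succ j ih =>
      intro k hk
      obtain ⟨c, rfl⟩ := Nat.exists_eq_add_of_le hk
      rw [show m + c + (j + 1) * (d + 1) = (m + d + 1 + c) + j * (d + 1) by ring,
        ih _ (by omega), pow_add, ← h, ← pow_add]
  -- Powers from exponent `m` on have period `d + 1`; this exponent is a multiple of the period and
  -- at least `m`.
  refine ⟨(m + 1) * (d + 1), by positivity, ?_⟩
  rw [IsIdempotentElem, ← pow_add]
  exact hper _ _ (by nlinarith [Nat.zero_le (m * d)])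

/-! ### Algebras with additive basic operations. -/

section Additive

/-- A basic operation as a homomorphism of abelian groups. -/
def basicHom (hidem : IsIdempotent L A)
    (hadd : ∀ (n : ℕ) (f : L.Functions n) (x y : Fin n → A),
      funMap f (fun i => x i + y i) = funMap f x + funMap f y)
    {n : ℕ} (f : L.Functions n) : (Fin n → A) →+ A where
  toFun x := funMap f x
  map_zero' := hidem n f 0
  map_add' := hadd n f

/-- The coefficient of a basic operation at a variable. -/
def basicCoeff (hidem : IsIdempotent L A)
    (hadd : ∀ (n : ℕ) (f : L.Functions n) (x y : Fin n → A),
      funMap f (fun i => x i + y i) = funMap f x + funMap f y)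
    {n : ℕ} (f : L.Functions n) (i : Fin n) : AddMonoid.End A :=
  (basicHom hidem hadd f).comp (AddMonoidHom.single (fun _ => A) i)

variable (hidem : IsIdempotent L A)
  (hadd : ∀ (n : ℕ) (f : L.Functions n) (x y : Fin n → A),
    funMap f (fun i => x i + y i) = funMap f x + funMap f y)

include hidem hadd

theorem basicCoeff_apply {n : ℕ} (f : L.Functions n) (i : Fin n) (a : A) :
    basicCoeff hidem hadd f i a = funMap f (Pi.single i a) := rfl

theorem funMap_eq_sum {n : ℕ} (f : L.Functions n) (x : Fin n → A) :
    funMap f x = ∑ i, basicCoeff hidem hadd f i (x i) := by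
  have := map_sum (basicHom hidem hadd f) (fun i => Pi.single i (x i)) Finset.univ
  rw [Finset.univ_sum_single] at this
  exact this

theorem funMap_sub {n : ℕ} (f : L.Functions n) (x y : Fin n → A) :
    funMap f (x - y) = funMap f x - funMap f y :=
  map_sub (basicHom hidem hadd f) x y

theorem basicCoeff_isCoefficient {n : ℕ} (f : L.Functions n) (i : Fin n) :
    IsCoefficient L (basicCoeff hidem hadd f i) := by
  have h := IsTermOperation.basic (L := L) (A := A) (n := 2) f
    (g := fun j x => if j = i then x 0 else x 1) fun j => by
      by_cases h : j = i
      · simpa [h] using IsTermOperation.proj (L := L) (A := A) (0 : Fin 2)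
      · simpa [h] using IsTermOperation.proj (L := L) (A := A) (1 : Fin 2)
  unfold IsCoefficient
  convert h using 2 with x
  rw [basicCoeff_apply, ← hidem n f (x 1), ← hadd, hidem]
  refine congrArg _ (funext fun j => ?_)
  by_cases hj : j = i
  · subst hj; simp
  · simp [hj]

/-- The cosets of a subgroup stable under all coefficients form a congruence, so simplicity acts as
irreducibility of a module. -/
theorem addSubgroup_eq_bot_or_top
    (hsimple : ∀ σ : Congruence L A, (∀ x y, σ.toSetoid x y → x = y) ∨ ∀ x y, σ.toSetoid x y)
    (H : AddSubgroup A) (hH : ∀ β, IsCoefficient L β → ∀ a ∈ H, β a ∈ H) :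
    (∀ a ∈ H, a = 0) ∨ ∀ a, a ∈ H := by
  let σ : Congruence L A := ⟨⟨fun x y => x - y ∈ H, fun x => by simp [H.zero_mem],
    fun {x y} h => by simpa using H.neg_mem h,
    fun {x y z} h h' => by simpa using H.add_mem h h'⟩, fun f x y h => by
      change funMap f x - funMap f y ∈ H
      rw [← funMap_sub hidem hadd, funMap_eq_sum hidem hadd]
      exact H.sum_mem fun i _ => hH _ (basicCoeff_isCoefficient hidem hadd f i) _ (h i)⟩
  rcases hsimple σ with h | h
  · exact Or.inl fun a ha => h a 0 (show a - 0 ∈ H by simpa using ha)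
  · exact Or.inr fun a => by
      have : a - 0 ∈ H := h a 0
      simpa using this

omit hidem hadd in
/-- If every translation coefficient vanishes, coefficients are trivial. -/
theorem IsCoefficient.eq_zero_or_one [Finite A]
    (hsub : ∀ H : AddSubgroup A, (∀ β, IsCoefficient L β → ∀ a ∈ H, β a ∈ H) →
      (∀ a ∈ H, a = 0) ∨ ∀ a, a ∈ H)
    (hJ : ∀ β : AddMonoid.End A, IsTranslation L β → β = 0)
    {β : AddMonoid.End A} (hβ : IsCoefficient L β) : β = 0 ∨ β = 1 := by
  have : Finite (AddMonoid.End A) := DFunLike.finite _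
  -- By finiteness the inverse is a power, hence again a coefficient, so inverse minus 1 is a
  -- translation and vanishes.
  have hunit : ∀ β : AddMonoid.End A, IsCoefficient L β → IsUnit β → β = 1 := by
    rintro _ hβ ⟨u, rfl⟩
    have hinv : ((u⁻¹ : (AddMonoid.End A)ˣ) : AddMonoid.End A) = u ^ (orderOf u - 1) := by
      rw [← Units.val_pow_eq_pow_val, Units.val_inj, inv_eq_iff_mul_eq_one, ← pow_succ',
        Nat.sub_add_cancel (orderOf_pos u), pow_orderOf_eq_one]
    have h := hJ _ (hβ.isTranslation_of_mul_eq_one (hinv ▸ hβ.pow _) u.inv_mul)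
    have h1 : u⁻¹ = 1 := Units.ext (by simpa using sub_eq_zero.1 h)
    rw [inv_eq_one.1 h1, Units.val_one]
  -- The product squares to zero, and 1 minus it is a coefficient and a unit. Applied to `e` and `1
  -- - e`, this makes idempotent coefficients commute with all coefficients, so their kernels are
  -- stable.
  have hnil : ∀ e γ : AddMonoid.End A, IsCoefficient L e → IsIdempotentElem e →
      IsCoefficient L γ → e * γ * (1 - e) = 0 := by
    intro e γ he hee hγ
    have hsq : (e * γ * (1 - e)) * (e * γ * (1 - e)) = 0 := by
      have : (1 - e) * e = 0 := by rw [sub_mul, one_mul, hee.eq, sub_self]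
      calc (e * γ * (1 - e)) * (e * γ * (1 - e)) = e * γ * ((1 - e) * e) * γ * (1 - e) := by
            noncomm_ring
        _ = 0 := by rw [this]; simp
    have hc : IsCoefficient L (1 - e * γ * (1 - e)) := by
      have := he.combine (hγ.mul he.one_sub).one_sub IsCoefficient.one
      convert this using 1
      noncomm_ring
    have := hunit _ hc (IsNilpotent.isUnit_one_sub ⟨2, by rw [pow_two, hsq]⟩)
    simpa using this
  have hidemp : ∀ e : AddMonoid.End A, IsCoefficient L e → IsIdempotentElem e →
      e = 0 ∨ e = 1 := by
    intro e he hee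
    have hcomm : ∀ γ, IsCoefficient L γ → e * γ = γ * e := by
      intro γ hγ
      have h1 := hnil e γ he hee hγ
      have h2 := hnil (1 - e) γ he.one_sub hee.one_sub hγ
      have h1' : e * γ - e * γ * e = 0 := by rw [← h1]; noncomm_ring
      have h2' : γ * e - e * γ * e = 0 := by rw [← h2]; noncomm_ring
      rw [sub_eq_zero.1 h1', sub_eq_zero.1 h2']
    rcases hsub (AddMonoidHom.ker (e : A →+ A)) (fun γ hγ a (ha : e a = 0) => by
      have := DFunLike.congr_fun (hcomm γ hγ) a
      rw [end_mul_apply, end_mul_apply, ha, map_zero] at this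
      exact this) with h | h
    · right
      ext a
      have : e (e a - a) = 0 := by
        rw [map_sub, sub_eq_zero]
        exact DFunLike.congr_fun hee.eq a
      exact sub_eq_zero.1 (h _ this)
    · left
      ext a
      exact h a
  obtain ⟨n, hn, hid⟩ := exists_pow_isIdempotentElem β
  rcases hidemp _ (hβ.pow n) hid with h | h
  · left
    have := hunit _ hβ.one_sub (IsNilpotent.isUnit_one_sub ⟨n, h⟩)
    simpa using this
  · exact Or.inr (hunit β hβ (IsUnit.of_pow_eq_one h hn))

/-- Otherwise all coefficients are 0 or 1. Idempotence excludes that a basic operation has only zero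
coefficients, and two coefficients 1 would give the term x + y - z. So each basic operation is a
projection and {0} is projective. -/
theorem exists_translation_ne_zero [Finite A] [Nontrivial A]
    (hsub : ∀ H : AddSubgroup A, (∀ β, IsCoefficient L β → ∀ a ∈ H, β a ∈ H) →
      (∀ a ∈ H, a = 0) ∨ ∀ a, a ∈ H)
    (hproj : ∀ B : L.Substructure A, IsProjective B → ¬ IsNontrivial B) :
    ∃ β : AddMonoid.End A, IsTranslation L β ∧ β ≠ 0 := by
  by_contra! hJ
  have h10 : (1 : AddMonoid.End A) ≠ 0 := by
    obtain ⟨a, ha⟩ := exists_ne (0 : A)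
    exact fun h => ha (DFunLike.congr_fun h a)
  let B : L.Substructure A := ⟨{0}, fun {n} f x hx => by
    have : x = fun _ => 0 := funext hx
    rw [this]
    exact hidem n f 0⟩
  refine hproj B (fun n f => ?_) ⟨⟨0, rfl⟩, fun h => ?_⟩
  · have hc := fun i => (basicCoeff_isCoefficient hidem hadd f i).eq_zero_or_one hsub hJ
    by_cases hall : ∀ i, basicCoeff hidem hadd f i = 0
    · obtain ⟨a, ha⟩ := exists_ne (0 : A)
      have := funMap_eq_sum hidem hadd f fun _ => a
      rw [hidem n f a] at this
      exact absurd (by simpa [hall] using this) ha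
    push Not at hall
    obtain ⟨i, hi⟩ := hall
    have hi := (hc i).resolve_left hi
    refine ⟨i, fun x hx => ?_⟩
    have hx : x i = 0 := hx
    change funMap f x = 0
    rw [funMap_eq_sum hidem hadd f]
    refine Finset.sum_eq_zero fun j _ => ?_
    by_cases hji : j = i
    · rw [hji, hx, map_zero]
    rcases hc j with hj | hj
    · rw [hj]; rfl
    exfalso
    refine h10 (hJ 1 ?_)
    have h := IsTermOperation.basic (L := L) (A := A) (n := 3) f
      (g := fun k x => if k = i then x 0 else if k = j then x 1 else x 2) fun k => by
        by_cases h : k = i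
        · simpa [h] using IsTermOperation.proj (L := L) (A := A) (0 : Fin 3)
        · by_cases h' : k = j
          · simpa [h', hji] using IsTermOperation.proj (L := L) (A := A) (1 : Fin 3)
          · simpa [h, h'] using IsTermOperation.proj (L := L) (A := A) (2 : Fin 3)
    unfold IsTranslation
    convert h using 2 with y
    have e1 : funMap f (Pi.single i (y 0 - y 2)) = y 0 - y 2 := by
      rw [← basicCoeff_apply hidem hadd, hi]; rfl
    have e2 : funMap f (Pi.single j (y 1 - y 2)) = y 1 - y 2 := by
      rw [← basicCoeff_apply hidem hadd, hj]; rfl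
    have e3 := hidem n f (y 2)
    calc y 0 + (1 : AddMonoid.End A) (y 1 - y 2) = (y 0 - y 2) + (y 1 - y 2) + y 2 := by
          rw [end_one_apply]
          abel
      _ = _ := by
        conv_lhs => rw [← e1, ← e2, ← e3, ← hadd, ← hadd]
        refine congrArg _ (funext fun k => ?_)
        rw [e3]
        by_cases hki : k = i
        · subst hki; simp [Ne.symm hji]
        · by_cases hkj : k = j
          · subst hkj; simp [hki]
          · simp [hki, hkj]
  · obtain ⟨a, ha⟩ := exists_ne (0 : A)
    have : a ∈ (B : Set A) := h ▸ Set.mem_univ a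
    exact ha this

-- An idempotent translation `e` with smallest kernel must be 1. If not, its kernel has a nonzero
-- `a`, and irreducibility gives a translation fixing `a`. Compressing by `1 - e` and taking an
-- idempotent power gives an idempotent orthogonal to `e` that fixes `a`; adding it to `e` shrinks
-- the kernel.
omit hidem hadd in
theorem isTranslation_one [Finite A]
    (hsub : ∀ H : AddSubgroup A, (∀ β, IsCoefficient L β → ∀ a ∈ H, β a ∈ H) →
      (∀ a ∈ H, a = 0) ∨ ∀ a, a ∈ H)
    {β : AddMonoid.End A} (hβ : IsTranslation L β) (hβ0 : β ≠ 0) :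
    IsTranslation L (1 : AddMonoid.End A) := by
  have : Finite (AddMonoid.End A) := DFunLike.finite _
  obtain ⟨e, ⟨heJ, hee⟩, hmin⟩ := Set.exists_min_image
    {e : AddMonoid.End A | IsTranslation L e ∧ IsIdempotentElem e}
    (fun e => {a | e a = 0}.ncard) (Set.toFinite _) ⟨0, IsTranslation.zero, by simp [IsIdempotentElem]⟩
  suffices h : e = 1 from h ▸ heJ
  by_contra hne
  obtain ⟨b, hb⟩ : ∃ b, e b ≠ b := by
    by_contra! h
    exact hne (AddMonoidHom.ext h)
  set a := b - e b with ha
  have ha0 : a ≠ 0 := fun h => hb (sub_eq_zero.1 h).symm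
  have hee' : ∀ x, e (e x) = e x := fun x => DFunLike.congr_fun hee.eq x
  have hea : e a = 0 := by rw [ha, map_sub, hee', sub_self]
  let K : AddSubgroup A :=
    { carrier := {x | ∀ γ : AddMonoid.End A, IsTranslation L γ → γ x = 0}
      zero_mem' := fun γ _ => map_zero γ
      add_mem' := fun {x y} hx hy γ hγ => by rw [map_add, hx γ hγ, hy γ hγ, add_zero]
      neg_mem' := fun {x} hx γ hγ => by rw [map_neg, hx γ hγ, neg_zero] }
  have hK : ∀ x ∈ K, x = 0 := by
    refine (hsub K fun δ hδ x hx γ hγ => hx (γ * δ) (hγ.mul_coefficient hδ)).resolve_right ?_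
    intro h
    exact hβ0 (AddMonoidHom.ext fun x => h x β hβ)
  let O : AddSubgroup A :=
    { carrier := {x | ∃ γ : AddMonoid.End A, IsTranslation L γ ∧ γ a = x}
      zero_mem' := ⟨0, IsTranslation.zero, rfl⟩
      add_mem' := by
        rintro _ _ ⟨γ, hγ, rfl⟩ ⟨δ, hδ, rfl⟩
        exact ⟨γ + δ, hγ.add hδ, rfl⟩
      neg_mem' := by
        rintro _ ⟨γ, hγ, rfl⟩
        exact ⟨-γ, hγ.neg, rfl⟩ }
  have hO : ∀ x, x ∈ O := by
    refine (hsub O ?_).resolve_left fun h => ?_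
    · rintro δ hδ _ ⟨γ, hγ, rfl⟩
      exact ⟨δ * γ, hδ.mul_translation hγ, rfl⟩
    · exact ha0 (hK a fun γ hγ => h _ ⟨γ, hγ, rfl⟩)
  obtain ⟨γ, hγ, hγa⟩ := hO a
  set δ := (1 - e) * γ * (1 - e) with hδ
  have hδJ : IsTranslation L δ :=
    (heJ.isCoefficient.one_sub.mul_translation hγ).mul_coefficient heJ.isCoefficient.one_sub
  have hfa : (1 - e) a = a := by rw [end_sub_apply, hea, sub_zero]; rfl
  have hδa : δ a = a := by
    rw [hδ, end_mul_apply, end_mul_apply, hfa, hγa, hfa]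
  have heδ : e * δ = 0 := by
    have : e * (1 - e) = 0 := by rw [mul_sub, mul_one, hee.eq, sub_self]
    rw [hδ, ← mul_assoc, ← mul_assoc, this, zero_mul, zero_mul]
  have hδe : δ * e = 0 := by
    have : (1 - e) * e = 0 := by rw [sub_mul, one_mul, hee.eq, sub_self]
    rw [hδ, mul_assoc, this, mul_zero]
  obtain ⟨n, hn, hid⟩ := exists_pow_isIdempotentElem δ
  have hga : (δ ^ n) a = a := by
    clear hid hn
    induction n with
    | zero => rfl
    | succ n ih => rw [pow_succ, end_mul_apply, hδa, ih]
  obtain ⟨k, rfl⟩ := Nat.exists_eq_succ_of_ne_zero hn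
  have heg : e * δ ^ (k + 1) = 0 := by rw [pow_succ', ← mul_assoc, heδ, zero_mul]
  have hge : δ ^ (k + 1) * e = 0 := by rw [pow_succ, mul_assoc, hδe, mul_zero]
  have hnew := hmin (e + δ ^ (k + 1)) ⟨heJ.add (hδJ.pow hn), by
    rw [IsIdempotentElem, mul_add, add_mul, add_mul, hee.eq, heg, hge]
    rw [show δ ^ (k + 1) * δ ^ (k + 1) = δ ^ (k + 1) from hid.eq]
    simp⟩
  refine absurd hnew (not_le.2 (Set.ncard_lt_ncard ⟨fun x hx => ?_, fun h => ?_⟩ (Set.toFinite _)))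
  · have hx : (e + δ ^ (k + 1)) x = 0 := hx
    have h1 : e * (e + δ ^ (k + 1)) = e := by rw [mul_add, hee.eq, heg, add_zero]
    have := DFunLike.congr_fun h1 x
    rw [end_mul_apply, hx, map_zero] at this
    exact this.symm
  · have : (e + δ ^ (k + 1)) a = 0 := h hea
    rw [end_add_apply, hea, hga, zero_add] at this
    exact ha0 this

theorem isPAffine_of_isTranslation_one [Finite A] [Nontrivial A]
    (hsub : ∀ H : AddSubgroup A, (∀ β, IsCoefficient L β → ∀ a ∈ H, β a ∈ H) →
      (∀ a ∈ H, a = 0) ∨ ∀ a, a ∈ H)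
    (h1 : IsTranslation L (1 : AddMonoid.End A)) : ∃ p : ℕ, p.Prime ∧ IsPAffine L A p := by
  have := Fintype.ofFinite A
  set p := (Fintype.card A).minFac with hp
  have hpp : p.Prime := Nat.minFac_prime Fintype.one_lt_card.ne'
  have : Fact p.Prime := ⟨hpp⟩
  obtain ⟨a, ha⟩ := exists_prime_addOrderOf_dvd_card p (Nat.minFac_dvd (Fintype.card A))
  -- The p-torsion is stable under coefficients and nonzero by Cauchy's theorem.
  have hpa : ∀ a : A, p • a = 0 := by
    refine (hsub (nsmulAddMonoidHom p : A →+ A).ker fun β _ x hx => ?_).resolve_left fun h => ?_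
    · rw [AddMonoidHom.mem_ker, nsmulAddMonoidHom_apply] at hx ⊢
      rw [← map_nsmul, hx, map_zero]
    · have ha0 : a = 0 := h a (by
        rw [AddMonoidHom.mem_ker, nsmulAddMonoidHom_apply, ← ha, addOrderOf_nsmul_eq_zero])
      rw [ha0, addOrderOf_zero] at ha
      exact hpp.one_lt.ne ha
  obtain ⟨_⟩ : Nonempty (Module (ZMod p) A) := ⟨AddCommGroup.zmodModule hpa⟩
  have : Module.Finite (ZMod p) A := Module.Finite.of_finite
  have e : A ≃ₗ[ZMod p] (Fin (Module.finrank (ZMod p) A) → ZMod p) :=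
    (Module.finBasis (ZMod p) A).equivFun
  refine ⟨p, hpp, inferInstance, hidem, (· + ·), (· - ·),
    ⟨Module.finrank (ZMod p) A, Module.finrank_pos, e.toEquiv, fun x y => map_add e x y,
      fun x y => map_sub e x y⟩, ?_, ?_⟩
  · intro n f α hα
    change funMap f _ + funMap f _ = funMap f _ + funMap f _
    rw [← hadd, ← hadd]
    exact congrArg _ (funext hα)
  · have := h1.apply (IsTermOperation.proj (L := L) (A := A) (0 : Fin 3)) (IsTermOperation.proj 2)
      (IsTermOperation.proj 1)
    convert this using 2 with x
    change x 0 - x 1 + x 2 = x 0 + (x 2 - x 1)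
    abel

end Additive

end Affine

/-! ### The dichotomy for simple algebras. -/

theorem IsStrongFree.polynomiallyComplete_or_affine {L : FirstOrder.Language.{u, v}} {A : Type w}
    [L.Structure A] [Finite A] [Nontrivial A] (hA : IsStrongFree L A) :
    IsPolynomiallyComplete L A ∨ ∃ p : ℕ, p.Prime ∧ IsPAffine L A p := by
  refine or_iff_not_imp_left.2 fun hPC => ?_
  obtain ⟨Q, hQ, h12, h13, h23, hne⟩ : ∃ Q : A → A → A → Prop, Compatible₃ L Q ∧
      (∀ x y, ∃ z, Q x y z) ∧ (∀ x z, ∃ y, Q x y z) ∧ (∀ y z, ∃ x, Q x y z) ∧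
      ¬ ∀ x y z, Q x y z := by
    by_contra hcon
    exact hPC (hA.isPolynomiallyComplete fun Q hQ h12 h13 h23 => by
      by_contra hne
      exact hcon ⟨Q, hQ, h12, h13, h23, hne⟩)
  obtain ⟨inst, hadd⟩ := hA.exists_addCommGroup hQ h12 h13 h23 hne
  have hsub := addSubgroup_eq_bot_or_top hA.idem hadd hA.simple
  obtain ⟨β, hβ, hβ0⟩ := exists_translation_ne_zero hA.idem hadd hsub hA.projective
  exact isPAffine_of_isTranslation_one hA.idem hadd hsub (isTranslation_one hsub hβ hβ0)

/-! ### Lifting from factor algebras -/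

section Factor

variable {L : FirstOrder.Language.{u, v}} {A : Type w} [L.Structure A]

theorem Congruence.cls_surjective (σ : Congruence L A) : Function.Surjective σ.cls :=
  fun q => Quotient.inductionOn q fun a => ⟨a, rfl⟩

theorem Congruence.cls_eq_iff (σ : Congruence L A) {a b : A} :
    σ.cls a = σ.cls b ↔ σ.toSetoid a b :=
  Quotient.eq (r := σ.toSetoid)

variable [L.IsAlgebraic]

theorem Congruence.isIdempotent (σ : Congruence L A) (hidem : IsIdempotent L A) :
    IsIdempotent L σ.Quot := by
  intro n f q
  obtain ⟨a, rfl⟩ := σ.cls_surjective q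
  rw [σ.funMap_cls f fun _ => a, hidem]

/-- The preimage of a subuniverse of a factor algebra. -/
def Congruence.preimage (σ : Congruence L A) (B : L.Substructure σ.Quot) : L.Substructure A where
  carrier := {a | σ.cls a ∈ B}
  fun_mem {n} f x hx := by
    change σ.cls (funMap f x) ∈ B
    rw [← σ.funMap_cls]
    exact B.fun_mem f _ hx

theorem Congruence.mem_preimage (σ : Congruence L A) {B : L.Substructure σ.Quot} {a : A} :
    a ∈ σ.preimage B ↔ σ.cls a ∈ B := Iff.rfl

theorem Congruence.isNontrivial_preimage (σ : Congruence L A) {B : L.Substructure σ.Quot}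
    (hB : IsNontrivial B) : IsNontrivial (σ.preimage B) := by
  obtain ⟨⟨q, hq⟩, hne⟩ := hB
  obtain ⟨a, rfl⟩ := σ.cls_surjective q
  refine ⟨⟨a, hq⟩, fun h => hne (Set.eq_univ_of_forall fun q => ?_)⟩
  obtain ⟨b, rfl⟩ := σ.cls_surjective q
  have : b ∈ (σ.preimage B : Set A) := h ▸ Set.mem_univ b
  exact this

theorem Congruence.exists_lift_term (σ : Congruence L A) {n : ℕ} {t : (Fin n → σ.Quot) → σ.Quot}
    (ht : IsTermOperation L t) : ∃ s : (Fin n → A) → A, IsTermOperation L s ∧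
      ∀ x, σ.cls (s x) = t fun i => σ.cls (x i) := by
  induction ht with
  | proj i => exact ⟨_, IsTermOperation.proj i, fun x => rfl⟩
  | comp f hf g _ ih =>
    obtain ⟨f, rfl⟩ := hf
    choose s hs h using ih
    refine ⟨_, IsTermOperation.basic f hs, fun x => ?_⟩
    rw [← σ.funMap_cls]
    exact congrArg _ (funext fun j => h j x)

theorem Congruence.absorbsWith_preimage (σ : Congruence L A) {B : L.Substructure σ.Quot} {n : ℕ}
    {t : (Fin n → σ.Quot) → σ.Quot} {s : (Fin n → A) → A}
    (hs : ∀ x, σ.cls (s x) = t fun i => σ.cls (x i)) (hB : AbsorbsWith B t) :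
    AbsorbsWith (σ.preimage B) s := by
  intro i x hx
  rw [σ.mem_preimage, hs]
  exact hB i _ hx

theorem Congruence.isBinaryAbsorbing_preimage (σ : Congruence L A) {B : L.Substructure σ.Quot}
    (hB : IsBinaryAbsorbing B) : IsBinaryAbsorbing (σ.preimage B) := by
  obtain ⟨t, ht, hB⟩ := hB
  obtain ⟨s, hs, h⟩ := σ.exists_lift_term ht
  exact ⟨s, hs, σ.absorbsWith_preimage h hB⟩

theorem Congruence.isCentral_preimage (σ : Congruence L A) {C : L.Substructure σ.Quot}
    (hC : IsCentral C) : IsCentral (σ.preimage C) := by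
  obtain ⟨⟨n, t, hn, ht, hB⟩, hcen⟩ := hC
  obtain ⟨s, hs, h⟩ := σ.exists_lift_term ht
  refine ⟨⟨n, s, hn, hs, σ.absorbsWith_preimage h hB⟩, fun a ha hmem => hcen (σ.cls a) ha ?_⟩
  have key : ∀ z ∈ Substructure.closure L (crossPairs (σ.preimage C) a),
      (fun i => σ.cls (z i)) ∈ Substructure.closure L (crossPairs C (σ.cls a)) := by
    intro z hz
    refine Substructure.closure_induction hz ?_ fun {n} f x hx => ?_
    · change (fun i => σ.cls (funMap f (fun j => x j i))) ∈
        Substructure.closure L (crossPairs C (σ.cls a))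
      simp only [← σ.funMap_cls]
      exact (Substructure.closure L (crossPairs C (σ.cls a))).fun_mem f _ hx
    · rintro z (⟨h0, h1⟩ | ⟨h0, h1⟩)
      · exact Substructure.subset_closure (Or.inl ⟨congrArg _ h0, h1⟩)
      · exact Substructure.subset_closure (Or.inr ⟨h0, congrArg _ h1⟩)
  exact key _ hmem

theorem Congruence.isProjective_preimage (σ : Congruence L A) {B : L.Substructure σ.Quot}
    (hB : IsProjective B) : IsProjective (σ.preimage B) := by
  intro n f
  obtain ⟨i, hi⟩ := hB n f
  refine ⟨i, fun x hx => ?_⟩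
  rw [σ.mem_preimage, ← σ.funMap_cls]
  exact hi _ hx

/-- The pullback of a congruence of a factor algebra. -/
def Congruence.pullback (σ : Congruence L A) (τ : Congruence L σ.Quot) : Congruence L A where
  toSetoid := τ.toSetoid.comap σ.cls
  preserved f x y h := by
    change τ.toSetoid (σ.cls _) (σ.cls _)
    rw [← σ.funMap_cls, ← σ.funMap_cls]
    exact τ.preserved f _ _ h

variable (L A) in
/-- A finite algebra with at least two elements has a maximal proper congruence. -/
theorem exists_maximal_congruence [Finite A] [Nontrivial A] :
    ∃ σ : Congruence L A, Nontrivial σ.Quot ∧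
      ∀ τ : Congruence L σ.Quot, (∀ x y, τ.toSetoid x y → x = y) ∨ ∀ x y, τ.toSetoid x y := by
  let eqCon : Congruence L A := ⟨⊥, fun f x y h => by
    have : x = y := funext h
    rw [this]⟩
  have : Finite (Congruence L A) :=
    Finite.of_injective (fun σ : Congruence L A => {p : A × A | σ.toSetoid p.1 p.2}) <| by
      rintro ⟨s, hs⟩ ⟨t, ht⟩ h
      have : s = t := Setoid.ext fun a b => Set.ext_iff.1 h (a, b)
      subst this
      rfl
  obtain ⟨a, b, hab⟩ := exists_pair_ne A
  -- Maximality is measured by the number of related pairs; a nontrivial proper congruence of the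
  -- factor would pull back to a larger one.
  obtain ⟨σ, hσ, hmax⟩ := Set.exists_max_image
    {σ : Congruence L A | ¬ ∀ x y, σ.toSetoid x y}
    (fun σ => {p : A × A | σ.toSetoid p.1 p.2}.ncard) (Set.toFinite _)
    ⟨eqCon, fun h => hab (h a b)⟩
  refine ⟨σ, ?_, fun τ => ?_⟩
  · have hσ : ¬ ∀ x y, σ.toSetoid x y := hσ
    push Not at hσ
    obtain ⟨x, y, hxy⟩ := hσ
    exact ⟨σ.cls x, σ.cls y, fun h => hxy (σ.cls_eq_iff.1 h)⟩
  · by_contra! hτ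
    obtain ⟨⟨q, q', h, hne⟩, r, r', hr⟩ := hτ
    obtain ⟨x, rfl⟩ := σ.cls_surjective q
    obtain ⟨y, rfl⟩ := σ.cls_surjective q'
    obtain ⟨z, rfl⟩ := σ.cls_surjective r
    obtain ⟨w, rfl⟩ := σ.cls_surjective r'
    refine absurd (hmax (σ.pullback τ) fun h => hr (h z w))
      (not_le.2 (Set.ncard_lt_ncard ⟨fun p hp => ?_, fun hsub => ?_⟩ (Set.toFinite _)))
    · change τ.toSetoid (σ.cls p.1) (σ.cls p.2)
      rw [σ.cls_eq_iff.2 hp]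
    · exact hne (σ.cls_eq_iff.2 (hsub (show (x, y) ∈ {p : A × A | (σ.pullback τ).toSetoid p.1 p.2}
        from h)))

/-- A block of a congruence, as a subuniverse of an idempotent algebra. -/
def Congruence.block (σ : Congruence L A) (hidem : IsIdempotent L A) (a : A) :
    L.Substructure A where
  carrier := {x | σ.toSetoid x a}
  fun_mem {n} f x hx := by
    have h := σ.preserved f x (fun _ => a) hx
    rw [hidem] at h
    exact h

theorem Congruence.isPCSubuniverse_block (σ : Congruence L A) (hidem : IsIdempotent L A) (a : A)
    (hσ : IsPCWithoutBACP L σ.Quot) : IsPCSubuniverse (σ.block hidem a) := by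
  refine Or.inr (Or.inr ⟨σ, ⟨a, rfl⟩, 1, fun _ => σ.Quot, fun _ => inferInstance, ⟨?_⟩,
    fun _ => hσ⟩)
  exact
    { toEquiv := (Equiv.funUnique (Fin 1) σ.Quot).symm
      map_fun' := fun f x => rfl
      map_rel' := fun r x => isEmptyElim r }

theorem Congruence.isNontrivial_block (σ : Congruence L A) [Nontrivial σ.Quot]
    (hidem : IsIdempotent L A) (a : A) : IsNontrivial (σ.block hidem a) := by
  refine ⟨⟨a, σ.toSetoid.refl a⟩, fun h => ?_⟩
  obtain ⟨q, hq⟩ := exists_ne (σ.cls a)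
  obtain ⟨b, rfl⟩ := σ.cls_surjective q
  have : b ∈ (σ.block hidem a : Set A) := h ▸ Set.mem_univ b
  exact hq (σ.cls_eq_iff.2 this)

end Factor

end UnivAlg

/-! ### The five cases. -/

theorem mainTheorem7 {L : FirstOrder.Language.{u, v}} [L.IsAlgebraic] {A : Type w} [L.Structure A]
    [Finite A] (hcard : 2 ≤ Nat.card A) (hidem : UnivAlg.IsIdempotent L A) :
    (∃ B : L.Substructure A, UnivAlg.IsNontrivial B ∧ UnivAlg.IsBinaryAbsorbing B) ∨
    (∃ C : L.Substructure A, UnivAlg.IsNontrivial C ∧ UnivAlg.IsCentral C) ∨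
    (∃ B : L.Substructure A, UnivAlg.IsNontrivial B ∧ UnivAlg.IsPCSubuniverse B) ∨
    (∃ (σ : UnivAlg.Congruence L A) (p : ℕ), p.Prime ∧ UnivAlg.IsPAffine L σ.Quot p) ∨
    (∃ B : L.Substructure A, UnivAlg.IsNontrivial B ∧ UnivAlg.IsProjective B) := by
  have : Nontrivial A := Finite.one_lt_card_iff_nontrivial.1 hcard
  obtain ⟨σ, hnt, hsimple⟩ := UnivAlg.exists_maximal_congruence L A
  by_cases hB : ∃ B : L.Substructure A, UnivAlg.IsNontrivial B ∧ UnivAlg.IsBinaryAbsorbing B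
  · exact Or.inl hB
  by_cases hC : ∃ C : L.Substructure A, UnivAlg.IsNontrivial C ∧ UnivAlg.IsCentral C
  · exact Or.inr (Or.inl hC)
  by_cases hP : ∃ B : L.Substructure A, UnivAlg.IsNontrivial B ∧ UnivAlg.IsProjective B
  · exact Or.inr (Or.inr (Or.inr (Or.inr hP)))
  have hQ : UnivAlg.IsStrongFree L σ.Quot :=
    ⟨σ.isIdempotent hidem, hsimple,
      fun B h hn => hB ⟨_, σ.isNontrivial_preimage hn, σ.isBinaryAbsorbing_preimage h⟩,
      fun B h hn => hC ⟨_, σ.isNontrivial_preimage hn, σ.isCentral_preimage h⟩,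
      fun B h hn => hP ⟨_, σ.isNontrivial_preimage hn, σ.isProjective_preimage h⟩⟩
  have : Finite σ.Quot := Finite.of_surjective _ σ.cls_surjective
  rcases hQ.polynomiallyComplete_or_affine with h | ⟨p, hp, h⟩
  · obtain ⟨a⟩ : Nonempty A := inferInstance
    refine Or.inr (Or.inr (Or.inl ⟨σ.block hidem a, σ.isNontrivial_block hidem a,
      σ.isPCSubuniverse_block hidem a ⟨h, ?_⟩⟩))
    rintro ⟨B, hn, h | h | h⟩
    exacts [hQ.binary B h hn, hQ.central B h hn, hQ.projective B h hn]
  · exact Or.inr (Or.inr (Or.inr (Or.inl ⟨σ, p, hp, h⟩)))
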